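/- For $n\ge 2$ let $A[B_n]$ be the Artin group of type $B_n$, that is, the group with generators $r_1,\dots,r_n$ and relations $r_ir_{i+1}r_i=r_{i+1}r_ir_{i+1}$ for $1\le i\le n-2$, $r_{n-1}r_nr_{n-1}r_n=r_nr_{n-1}r_nr_{n-1}$, and $r_ir_j=r_jr_i$ for $|i-j|\ge 2$. Let $Z(A[B_n])$ be its center and $\pi\colon A[B_n]\to A[B_n]/Z(A[B_n])$ the canonical projection. Let $n\ge 5$. Then every endomorphism of $A[B_n]/Z(A[B_n])$ lifts to an endomorphism of $A[B_n]$: for every group homomorphism $\phi\colon A[B_n]/Z(A[B_n])\to A[B_n]/Z(A[B_n])$ there exists a group homomorphism $\varphi\colon A[B_n]\to A[B_n]$ such that $\pi\circ\varphi=\phi\circ\pi$. -/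

import Mathlib

/-- The alternating product `Π(a, b, m) = a b a ⋯` with `m` factors, starting with `a`. -/
def altProd {G : Type*} [Monoid G] (a b : G) : ℕ → G
  | 0 => 1
  | m + 1 => a * altProd b a m

/-- The Artin relators `Π(s, t, m) * Π(t, s, m)⁻¹`, with `m = M s t`, over all `s ≠ t` such that
`M s t` is finite. As in Mathlib's `CoxeterMatrix`, the entry `0` stands for `∞`. -/
def artinRelations {S : Type*} (M : CoxeterMatrix S) : Set (FreeGroup S) :=
  {w | ∃ s t : S, s ≠ t ∧ M s t ≠ 0 ∧
    w = altProd (FreeGroup.of s) (FreeGroup.of t) (M s t) *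
      (altProd (FreeGroup.of t) (FreeGroup.of s) (M s t))⁻¹}

/-- The Artin group of a Coxeter matrix `M` over `S`, given by its standard presentation. -/
abbrev ArtinGroup {S : Type*} (M : CoxeterMatrix S) : Type _ :=
  PresentedGroup (artinRelations M)

/-- The Artin group `A[B_n]`. The vertices of the Coxeter graph `B_n` are indexed by `Fin n`, in
their order along the path, and the edge labeled `4` joins the last two of them. -/
abbrev ArtinB (n : ℕ) : Type := ArtinGroup (CoxeterMatrix.B n)

/-- The quotient of a group by its center. -/
abbrev ModCenter (G : Type*) [Group G] : Type _ := G ⧸ Subgroup.center G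

/-- The canonical projection of a group onto its quotient by the center. -/
abbrev modCenterProj (G : Type*) [Group G] : G →* ModCenter G :=
  QuotientGroup.mk' (Subgroup.center G)

/-- The endomorphism `f` of `G` is a lift of the endomorphism `φ` of `G / Z(G)`: the square
formed by `f`, `φ` and the canonical projection `π` commutes, that is, `π ∘ f = φ ∘ π`. -/
def IsLift {G : Type*} [Group G] (f : G →* G) (φ : ModCenter G →* ModCenter G) : Prop :=
  (modCenterProj G).comp f = φ.comp (modCenterProj G)

/-!
Write `G = A[B_n]` and `π : G → G / Z(G)`. Choose preimages in `G` of the images under `φ` of the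
generators; they satisfy the Artin relations up to central factors. The center of `G` contains no
nontrivial element of length zero (`eq_one_of_mem_center_of_lengthHom_eq_one`), where the length
`G → ℤ` sends all generators to `1`. Both sides of a relation of even length have the same length
for any choice of elements, so these relations hold exactly. The braid relations are
`r_i r_{i+1} r_i = r_{i+1} r_i r_{i+1}` along a path, and they can be made exact one after the other
by multiplying the next element by a central one (`exists_braid_lift`), which does not affect the
relations of even length.

The center is determined with Garside's method. In the Artin monoid of type `B_n`, common right
multiples of two generators are multiples of the obvious lcm (`ArtinMonoid.exists_of_gen_mul_eq`).
This is proved by induction on the length and on a derivation of the equality in question, which reduces it to the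
cube condition for each triple of generators; that condition is checked by word reversing
(`CoxeterMatrix.cubeCondition_B`). Number the generators of type `B_n` by `t_0, …, t_{n-1}` from the
end of the graph with the label `4`. The palindromes `x_k = t_k ⋯ t_1 t_0 t_1 ⋯ t_k` commute, their
product `z` is central, and `z` divides each element that all generators divide
(`ArtinMonoid.garsideB_dvd`). By connectedness of the Coxeter graph all generators divide every
central element other than `1`, so the central elements of the monoid are the powers of `z`
(`ArtinMonoid.central_eq_pow`). Finally the monoid embeds into `G`, because it embeds into its
localization at the powers of `z` (`ArtinGroup.ofMonoid_injective`), and every element of `G` is the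
product of an element of the monoid and a power of `z⁻¹`.
-/

/-! ### Artin monoids -/

/-- The Artin relations as relations between positive words. -/
def artinMonoidRel {S : Type*} (M : CoxeterMatrix S) (u v : FreeMonoid S) : Prop :=
  ∃ s t : S, s ≠ t ∧ M s t ≠ 0 ∧ u = altProd (FreeMonoid.of s) (FreeMonoid.of t) (M s t) ∧
    v = altProd (FreeMonoid.of t) (FreeMonoid.of s) (M s t)

/-- The Artin monoid of a Coxeter matrix: the monoid with the presentation of the Artin group. -/
abbrev ArtinMonoid {S : Type*} (M : CoxeterMatrix S) : Type _ :=
  PresentedMonoid (artinMonoidRel M)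

theorem map_altProd {G H F : Type*} [Monoid G] [Monoid H] [FunLike F G H] [MonoidHomClass F G H]
    (f : F) (a b : G) (m : ℕ) : f (altProd a b m) = altProd (f a) (f b) m := by
  induction m generalizing a b with
  | zero => exact map_one f
  | succ m ih => rw [altProd, altProd, map_mul, ih]

/-- The word `a b a ⋯` with `m` letters. -/
def altWord {ι : Type*} (a b : ι) : ℕ → List ι
  | 0 => []
  | m + 1 => a :: altWord b a m

/-- The word `i \ j` such that `i (i \ j)` is the lcm `i j i ⋯` of the letters `i` and `j`, where
`m i j` is the length of this lcm if `i ≠ j`. -/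
def letterCompl {ι : Type*} [DecidableEq ι] (m : Matrix ι ι ℕ) (i j : ι) : List ι :=
  if i = j then [] else altWord j i (m i j - 1)

/-- Right reversing: a pair `(x, y)` of words such that `u x` and `v y` both represent the lcm of
`u` and `v`. The first argument bounds the depth of the recursion. -/
def reverseWords {ι : Type*} [DecidableEq ι] (m : Matrix ι ι ℕ) :
    ℕ → List ι → List ι → Option (List ι × List ι)
  | _, [], v => some (v, [])
  | _, i :: u, [] => some ([], i :: u)
  | 0, _ :: _, _ :: _ => none
  | k + 1, i :: u, j :: v =>
    (reverseWords m k u (letterCompl m i j)).bind fun p =>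
      (reverseWords m k (letterCompl m j i ++ p.2) v).bind fun q => some (p.1 ++ q.1, q.2)

/-- The cube condition for the letters `0`, `1`, `2`: the lcm of `1 \ 0` and `1 \ 2` is
`(1 \ 0) p` and `(1 \ 2) q`, and reversing yields a word `e` with `(0 \ 1) p = (0 \ 2) e` and
`(2 \ 1) q = (2 \ 0) e`, so that the lcm of the three letters is `0 (0 \ 2) e`. The recursion bound
`20` is large enough for all matrices of type `B`. -/
def CubeCondition (m : Matrix (Fin 3) (Fin 3) ℕ) : Prop :=
  ∃ p q e, reverseWords m 20 (letterCompl m 1 0) (letterCompl m 1 2) = some (p, q) ∧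
    reverseWords m 20 (letterCompl m 0 1 ++ p) (letterCompl m 0 2) = some ([], e) ∧
    reverseWords m 20 (letterCompl m 2 1 ++ q) (letterCompl m 2 0 ++ e) = some ([], [])

theorem letterCompl_map {ι S : Type*} [DecidableEq ι] [DecidableEq S] {f : ι → S}
    (hf : Function.Injective f) (m : Matrix S S ℕ) (i j : ι) :
    (letterCompl (m.submatrix f f) i j).map f = letterCompl m (f i) (f j) := by
  have key : ∀ (k : ℕ) (a b : ι), (altWord a b k).map f = altWord (f a) (f b) k := by
    intro k
    induction k with
    | zero => intros; rfl
    | succ k ih => intro a b; simp [altWord, ih]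
  by_cases h : i = j
  · simp [letterCompl, h]
  · simp [letterCompl, h, hf.ne h, key]

namespace ArtinMonoid

variable {S : Type*} {M : CoxeterMatrix S}

/-- The generator of the Artin monoid at the vertex `s`. -/
def gen (M : CoxeterMatrix S) (s : S) : ArtinMonoid M := PresentedMonoid.of _ s

/-- The element of the Artin monoid represented by a word. -/
def eval (M : CoxeterMatrix S) (l : List S) : ArtinMonoid M := (l.map (gen M)).prod

@[simp] theorem eval_nil : eval M [] = 1 := rfl

@[simp] theorem eval_cons (s : S) (l : List S) : eval M (s :: l) = gen M s * eval M l := by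
  simp [eval]

@[simp] theorem eval_append (l l' : List S) : eval M (l ++ l') = eval M l * eval M l' := by
  simp [eval]

theorem mk_eq_eval (w : FreeMonoid S) : PresentedMonoid.mk _ w = eval M w.toList := by
  induction w using FreeMonoid.recOn with
  | one => simp
  | of_mul x xs ih => rw [map_mul, ih, FreeMonoid.toList_of_mul, eval_cons]; rfl

theorem exists_eval (a : ArtinMonoid M) : ∃ l, a = eval M l := by
  obtain ⟨w, rfl⟩ := PresentedMonoid.surjective_mk a
  exact ⟨_, mk_eq_eval w⟩

theorem eval_altWord (s t : S) (m : ℕ) :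
    eval M (altWord s t m) = altProd (gen M s) (gen M t) m := by
  induction m generalizing s t with
  | zero => rfl
  | succ m ih => rw [altWord, altProd, eval_cons, ih]

theorem altProd_gen (s t : S) :
    altProd (gen M s) (gen M t) (M s t) = altProd (gen M t) (gen M s) (M s t) := by
  rcases eq_or_ne s t with rfl | h
  · rfl
  by_cases h0 : M s t = 0
  · rw [h0]; rfl
  have := PresentedMonoid.mk_eq_mk_of_rel (rels := artinMonoidRel M) ⟨s, t, h, h0, rfl, rfl⟩
  rwa [map_altProd, map_altProd] at this

/-- The length homomorphism of the Artin monoid, in additive notation. -/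
def lengthHom (M : CoxeterMatrix S) : ArtinMonoid M →* Multiplicative ℕ :=
  PresentedMonoid.lift (fun _ => Multiplicative.ofAdd 1) (by
    rintro _ _ ⟨s, t, -, -, rfl, rfl⟩
    simp only [map_altProd, FreeMonoid.lift_eval_of])

/-- The word length on the Artin monoid; all words representing an element have the same length. -/
def length (a : ArtinMonoid M) : ℕ := (lengthHom M a).toAdd

@[simp] theorem length_one : length (1 : ArtinMonoid M) = 0 := by simp [length]

@[simp] theorem length_mul (a b : ArtinMonoid M) : length (a * b) = length a + length b := by
  simp [length]

@[simp] theorem length_gen (s : S) : length (gen M s) = 1 := rfl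

@[simp] theorem length_eval (l : List S) : length (eval M l) = l.length := by
  induction l with
  | nil => simp
  | cons s l ih => simp [ih, add_comm]

theorem exists_eq_gen_mul {a : ArtinMonoid M} (h : a ≠ 1) : ∃ s b, a = gen M s * b := by
  obtain ⟨l, rfl⟩ := exists_eval a
  cases l with
  | nil => simp at h
  | cons s l => exact ⟨s, _, eval_cons s l⟩

/-! ### Word reversing -/

variable [DecidableEq S]

theorem gen_mul_letterCompl (hM : ∀ s t, M s t ≠ 0) (s t : S) :
    gen M s * eval M (letterCompl M.M s t) = gen M t * eval M (letterCompl M.M t s) := by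
  rcases eq_or_ne s t with rfl | h
  · rfl
  obtain ⟨k, hk⟩ := Nat.exists_eq_succ_of_ne_zero (hM s t)
  have := altProd_gen (M := M) s t
  rw [hk, altProd, altProd] at this
  simpa [letterCompl, h, h.symm, M.symmetric t s, hk, eval_altWord] using this

/-- Any common right multiple `s a = t b` of two letters, with `a` of length less than `L`, is a
multiple of their lcm. -/
def LettersHaveLcmBelow (M : CoxeterMatrix S) (L : ℕ) : Prop :=
  ∀ (s t : S) (a b : ArtinMonoid M), length a < L → gen M s * a = gen M t * b →
    ∃ c, a = eval M (letterCompl M.M s t) * c ∧ b = eval M (letterCompl M.M t s) * c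

theorem LettersHaveLcmBelow.eval_mul_left_cancel {L : ℕ} (h : LettersHaveLcmBelow M L)
    (l : List S) {a b : ArtinMonoid M} (hL : l.length + length a ≤ L)
    (hab : eval M l * a = eval M l * b) : a = b := by
  induction l with
  | nil => simpa using hab
  | cons s l ih =>
    simp only [eval_cons, mul_assoc, List.length_cons] at hab hL
    obtain ⟨c, h1, h2⟩ := h s s _ _ (by simp; omega) hab
    exact ih (by omega) (h1.trans h2.symm)

section Reversing

variable {ι : Type*} [DecidableEq ι] {f : ι → S}

/-- Reversing computes common multiples. -/
theorem eval_mul_of_reverseWords (hM : ∀ s t, M s t ≠ 0) (hf : Function.Injective f) (k : ℕ) :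
    ∀ {u v x y : List ι},
      reverseWords (M.M.submatrix f f) k u v = some (x, y) →
      eval M (u.map f) * eval M (x.map f) = eval M (v.map f) * eval M (y.map f) := by
  induction k with
  | zero =>
    rintro (_ | ⟨i, u⟩) (_ | ⟨j, v⟩) x y h <;>
      simp [reverseWords] at h <;> obtain ⟨rfl, rfl⟩ := h <;> simp
  | succ k ih =>
    rintro (_ | ⟨i, u⟩) (_ | ⟨j, v⟩) x y h
    · simp [reverseWords] at h; obtain ⟨rfl, rfl⟩ := h; simp
    · simp [reverseWords] at h; obtain ⟨rfl, rfl⟩ := h; simp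
    · simp [reverseWords] at h; obtain ⟨rfl, rfl⟩ := h; simp
    · simp only [reverseWords, Option.bind_eq_some_iff] at h
      obtain ⟨⟨x₁, y₁⟩, h1, ⟨x₂, y₂⟩, h2, h3⟩ := h
      simp only [Option.some.injEq, Prod.mk.injEq] at h3
      obtain ⟨rfl, rfl⟩ := h3
      have e1 := ih h1
      have e2 := ih h2
      have e3 := gen_mul_letterCompl hM (f i) (f j)
      rw [List.map_append, eval_append] at e2
      rw [letterCompl_map hf] at e1 e2
      simp only [List.map_cons, List.map_append, eval_cons, eval_append]
      calc _ = gen M (f i) * (eval M (u.map f) * eval M (x₁.map f)) * eval M (x₂.map f) := by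
            simp only [mul_assoc]
        _ = (gen M (f i) * eval M (letterCompl M.M (f i) (f j))) * eval M (y₁.map f)
              * eval M (x₂.map f) := by rw [e1]; simp only [mul_assoc]
        _ = gen M (f j) * (eval M (letterCompl M.M (f j) (f i)) * eval M (y₁.map f)
              * eval M (x₂.map f)) := by rw [e3]; simp only [mul_assoc]
        _ = _ := by rw [e2]; simp only [mul_assoc]

/-- Reversing computes least common multiples, as far as these are known to exist for letters. -/
theorem LettersHaveLcmBelow.exists_of_reverseWords {L : ℕ} (hL : LettersHaveLcmBelow M L)
    (hf : Function.Injective f) (k : ℕ) :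
    ∀ {u v x y : List ι} {a b : ArtinMonoid M},
      reverseWords (M.M.submatrix f f) k u v = some (x, y) →
      u.length + length a ≤ L → eval M (u.map f) * a = eval M (v.map f) * b →
      ∃ c, a = eval M (x.map f) * c ∧ b = eval M (y.map f) * c := by
  induction k with
  | zero =>
    rintro (_ | ⟨i, u⟩) (_ | ⟨j, v⟩) x y a b h - hab <;>
      simp [reverseWords] at h <;> obtain ⟨rfl, rfl⟩ := h
    · exact ⟨a, by simpa using hab.symm⟩
    · exact ⟨b, by simpa using hab⟩
    · exact ⟨a, by simpa using hab.symm⟩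
  | succ k ih =>
    rintro (_ | ⟨i, u⟩) (_ | ⟨j, v⟩) x y a b h hl hab
    · simp [reverseWords] at h; obtain ⟨rfl, rfl⟩ := h
      exact ⟨a, by simpa using hab.symm⟩
    · simp [reverseWords] at h; obtain ⟨rfl, rfl⟩ := h
      exact ⟨b, by simpa using hab⟩
    · simp [reverseWords] at h; obtain ⟨rfl, rfl⟩ := h
      exact ⟨a, by simpa using hab.symm⟩
    · simp only [reverseWords, Option.bind_eq_some_iff] at h
      obtain ⟨⟨x₁, y₁⟩, h1, ⟨x₂, y₂⟩, h2, h3⟩ := h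
      simp only [Option.some.injEq, Prod.mk.injEq] at h3
      obtain ⟨rfl, rfl⟩ := h3
      simp only [List.map_cons, eval_cons, mul_assoc, List.length_cons] at hab hl
      have hlen := congrArg length hab
      simp only [length_mul, length_gen, length_eval, List.length_map] at hlen
      obtain ⟨c, hc1, hc2⟩ := hL _ _ _ _ (by simp; omega) hab
      rw [← letterCompl_map hf] at hc1 hc2
      obtain ⟨c₁, rfl, rfl⟩ := ih h1 (by omega) hc1
      have hlen' := congrArg length hc2
      simp only [length_mul, length_eval, List.length_map] at hlen'
      obtain ⟨c₂, rfl, rfl⟩ := ih (a := c₁) (b := b) h2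
        (by simp only [List.length_append]; omega)
        (by rw [hc2, List.map_append, eval_append, mul_assoc])
      exact ⟨c₂, by simp [mul_assoc], rfl⟩

end Reversing

/-! ### Least common multiples of generators -/

/-- The transitivity step of the lcm property: an element `s u = r u' = t v` with
`u = (s \ r) a`, `u' = (r \ s) a = (r \ t) b` and `v = (t \ r) b` is a multiple of the lcm of `s` and
`t`. For distinct letters this is the cube condition, applied to the shorter element `u'`. -/
theorem LettersHaveLcmBelow.cube {L : ℕ} (hL : LettersHaveLcmBelow M L)
    (hM : ∀ s t, M s t ≠ 0)
    (hcube : ∀ f : Fin 3 → S, Function.Injective f → CubeCondition (M.M.submatrix f f))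
    {s r t : S} {a b : ArtinMonoid M}
    (hlen : (letterCompl M.M r s).length + length a ≤ L)
    (h : eval M (letterCompl M.M r s) * a = eval M (letterCompl M.M r t) * b) :
    ∃ c, eval M (letterCompl M.M s r) * a = eval M (letterCompl M.M s t) * c ∧
      eval M (letterCompl M.M t r) * b = eval M (letterCompl M.M t s) * c := by
  rcases eq_or_ne s r with rfl | hsr
  · exact ⟨b, by simpa [letterCompl] using h, rfl⟩
  rcases eq_or_ne r t with rfl | hrt
  · exact ⟨a, rfl, by simpa [letterCompl] using h.symm⟩
  rcases eq_or_ne s t with rfl | hst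
  · exact ⟨eval M (letterCompl M.M s r) * a, by simp [letterCompl],
      by rw [hL.eval_mul_left_cancel _ hlen h]; simp [letterCompl]⟩
  have hf : Function.Injective ![s, r, t] := by
    intro i j hij
    fin_cases i <;> fin_cases j <;> simp_all
  obtain ⟨p, q, e, h1, h2, h3⟩ := hcube _ hf
  have E (i j) := letterCompl_map (f := ![s, r, t]) hf M i j
  have hlen' : (letterCompl (M.M.submatrix ![s, r, t] ![s, r, t]) 1 0).length
      = (letterCompl M.M r s).length := by
    rw [← List.length_map ![s, r, t], E]; rfl
  obtain ⟨c, rfl, rfl⟩ := hL.exists_of_reverseWords hf 20 (a := a) (b := b) h1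
    (by rw [hlen']; exact hlen) (by rw [E, E]; exact h)
  have e2 := eval_mul_of_reverseWords hM hf 20 h2
  have e3 := eval_mul_of_reverseWords hM hf 20 h3
  simp only [List.map_append, E, eval_append, List.map_nil, eval_nil, mul_one] at e2 e3
  refine ⟨eval M (e.map ![s, r, t]) * c, ?_, ?_⟩
  · rw [← mul_assoc, ← mul_assoc]; exact congrArg (· * c) e2
  · rw [← mul_assoc, ← mul_assoc]; exact congrArg (· * c) e3

/-- The lcm property of two letters for two given words representing the same element. -/
def HeadsHaveLcm (M : CoxeterMatrix S) (w w' : FreeMonoid S) : Prop :=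
  ∀ (s t : S) (u v : FreeMonoid S), w = FreeMonoid.of s * u → w' = FreeMonoid.of t * v →
    ∃ c, PresentedMonoid.mk _ u = eval M (letterCompl M.M s t) * c ∧
      PresentedMonoid.mk _ v = eval M (letterCompl M.M t s) * c

/-- The lcm property is inherited along a derivation of an equality of words. Only the transitivity
rule needs an argument, and it uses the lcm property for strictly shorter elements. -/
theorem headsHaveLcm_of_conGenRel {L : ℕ} (hL : LettersHaveLcmBelow M L)
    (hM : ∀ s t, M s t ≠ 0)
    (hcube : ∀ f : Fin 3 → S, Function.Injective f → CubeCondition (M.M.submatrix f f))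
    {w w' : FreeMonoid S} (h : ConGen.Rel (artinMonoidRel M) w w') (hw : w.length ≤ L + 1) :
    HeadsHaveLcm M w w' := by
  have hlen : ∀ {w w' : FreeMonoid S}, ConGen.Rel (artinMonoidRel M) w w' →
      w.length = w'.length := by
    intro w w' h
    have : PresentedMonoid.mk (artinMonoidRel M) w = PresentedMonoid.mk _ w' :=
      PresentedMonoid.mk_eq_mk_iff.2 h
    rw [mk_eq_eval, mk_eq_eval] at this
    exact (length_eval _).symm.trans ((congrArg length this).trans (length_eval _))
  have hcons : ∀ {w : FreeMonoid S}, w.length ≠ 0 → ∃ s u, w = FreeMonoid.of s * u := by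
    intro w
    induction w using FreeMonoid.casesOn with
    | one => simp
    | of_mul s u => exact fun _ => ⟨s, u, rfl⟩
  have hinj : ∀ {s t : S} {u v : FreeMonoid S},
      FreeMonoid.of s * u = FreeMonoid.of t * v → s = t ∧ u = v := by
    intro s t u v h
    exact List.cons.inj h
  induction h with
  | of x y hxy =>
    intro s t u v hu hv
    obtain ⟨a, b, hab, h0, rfl, rfl⟩ := hxy
    obtain ⟨k, hk⟩ := Nat.exists_eq_succ_of_ne_zero h0
    rw [hk, altProd] at hu hv
    obtain ⟨rfl, rfl⟩ := hinj hu
    obtain ⟨rfl, rfl⟩ := hinj hv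
    refine ⟨1, ?_, ?_⟩
    · simp [letterCompl, hab, hk, eval_altWord, map_altProd]; rfl
    · simp [letterCompl, hab.symm, M.symmetric b a, hk, eval_altWord, map_altProd]; rfl
  | refl x =>
    intro s t u v hu hv
    obtain ⟨rfl, rfl⟩ := hinj (hu.symm.trans hv)
    exact ⟨PresentedMonoid.mk _ u, by simp [letterCompl]⟩
  | symm h ih =>
    intro s t u v hu hv
    obtain ⟨c, h1, h2⟩ := ih (by rw [hlen h]; exact hw) t s v u hv hu
    exact ⟨c, h2, h1⟩
  | @trans x y z hxy hyz ih1 ih2 =>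
    intro s t u v hu hv
    have hxy' := hlen hxy
    obtain ⟨r, u', hy⟩ := hcons (w := y) (by rw [← hxy', hu]; simp)
    obtain ⟨a, ha1, ha2⟩ := ih1 hw s r u u' hu hy
    obtain ⟨b, hb1, hb2⟩ := ih2 (by omega) r t u' v hy hv
    rw [ha1, hb2]
    refine hL.cube hM hcube ?_ (ha2.symm.trans hb1)
    have := congrArg length ha2
    rw [mk_eq_eval, length_eval, length_mul, length_eval] at this
    rw [← this]
    have h3 : y.length = u'.length + 1 := by rw [hy]; simp [add_comm]
    have h4 : u'.toList.length = u'.length := rfl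
    omega
  | @mul w x y z hwx hyz ih1 ih2 =>
    intro s t u v hu hv
    have hwx' := hlen hwx
    have e : PresentedMonoid.mk (artinMonoidRel M) y = PresentedMonoid.mk _ z :=
      PresentedMonoid.mk_eq_mk_iff.2 hyz
    rw [FreeMonoid.length_mul] at hw
    by_cases h0 : w.length = 0
    · have hx0 : x.length = 0 := hwx' ▸ h0
      rw [FreeMonoid.length_eq_zero] at h0 hx0
      rw [h0, one_mul] at hu
      rw [hx0, one_mul] at hv
      exact ih2 (by omega) s t u v hu hv
    · obtain ⟨s', u', rfl⟩ := hcons h0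
      obtain ⟨t', v', rfl⟩ := hcons (hwx' ▸ h0)
      rw [mul_assoc] at hu hv
      obtain ⟨rfl, rfl⟩ := hinj hu
      obtain ⟨rfl, rfl⟩ := hinj hv
      obtain ⟨c, h1, h2⟩ := ih1 (by omega) s' t' u' v' rfl rfl
      exact ⟨c * PresentedMonoid.mk _ y, by rw [map_mul, h1, mul_assoc],
        by rw [map_mul, h2, mul_assoc, e]⟩

theorem lettersHaveLcmBelow (hM : ∀ s t, M s t ≠ 0)
    (hcube : ∀ f : Fin 3 → S, Function.Injective f → CubeCondition (M.M.submatrix f f))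
    (L : ℕ) : LettersHaveLcmBelow M L := by
  induction L with
  | zero => exact fun _ _ _ _ h => absurd h (Nat.not_lt_zero _)
  | succ L ih =>
    intro s t a b ha hab
    obtain ⟨u, rfl⟩ := PresentedMonoid.surjective_mk a
    obtain ⟨v, rfl⟩ := PresentedMonoid.surjective_mk b
    refine headsHaveLcm_of_conGenRel ih hM hcube (w := FreeMonoid.of s * u)
      (w' := FreeMonoid.of t * v) (PresentedMonoid.mk_eq_mk_iff.1 ?_) ?_ s t u v rfl rfl
    · rw [map_mul, map_mul]; exact hab
    · rw [mk_eq_eval, length_eval] at ha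
      have : u.toList.length = u.length := rfl
      simp only [FreeMonoid.length_mul, FreeMonoid.length_of]
      omega

/-- Every common right multiple of two generators is a multiple of their lcm. -/
theorem exists_of_gen_mul_eq (hM : ∀ s t, M s t ≠ 0)
    (hcube : ∀ f : Fin 3 → S, Function.Injective f → CubeCondition (M.M.submatrix f f))
    {s t : S} {a b : ArtinMonoid M} (h : gen M s * a = gen M t * b) :
    ∃ c, a = eval M (letterCompl M.M s t) * c ∧ b = eval M (letterCompl M.M t s) * c :=
  lettersHaveLcmBelow hM hcube (length a + 1) s t a b (Nat.lt_succ_self _) h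

theorem mul_left_cancel_of_cube (hM : ∀ s t, M s t ≠ 0)
    (hcube : ∀ f : Fin 3 → S, Function.Injective f → CubeCondition (M.M.submatrix f f))
    {a b c : ArtinMonoid M} (h : a * b = a * c) : b = c := by
  obtain ⟨l, rfl⟩ := exists_eval a
  exact (lettersHaveLcmBelow hM hcube _).eval_mul_left_cancel l le_rfl h

end ArtinMonoid

/-! ### The cube condition in type B -/

namespace CoxeterMatrix

theorem B_apply_cases {n : ℕ} {i j : Fin n} (h : i ≠ j) :
    (CoxeterMatrix.B n i j = 4 ∧ ((i : ℕ) + 1 = j ∧ (j : ℕ) + 1 = n ∨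
      (j : ℕ) + 1 = i ∧ (i : ℕ) + 1 = n)) ∨
    (CoxeterMatrix.B n i j = 3 ∧ ((i : ℕ) + 1 = j ∧ (j : ℕ) + 1 ≠ n ∨
      (j : ℕ) + 1 = i ∧ (i : ℕ) + 1 ≠ n)) ∨
    (CoxeterMatrix.B n i j = 2 ∧ (i : ℕ) + 1 ≠ j ∧ (j : ℕ) + 1 ≠ i) := by
  have hi := i.2
  have hj := j.2
  have hij : (i : ℕ) ≠ j := fun e => h (Fin.ext e)
  simp only [CoxeterMatrix.B, Matrix.of_apply, if_neg h]
  split_ifs <;> simp <;> omega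

theorem B_ne_zero (n : ℕ) (i j : Fin n) : CoxeterMatrix.B n i j ≠ 0 := by
  rcases eq_or_ne i j with rfl | h
  · simp
  · rcases B_apply_cases h with h | h | h <;> simp [h.1]

theorem cubeCondition_B {n : ℕ} (f : Fin 3 → Fin n) (hf : Function.Injective f) :
    CubeCondition ((CoxeterMatrix.B n).M.submatrix f f) := by
  have h01 : f 0 ≠ f 1 := hf.ne (by decide)
  have h12 : f 1 ≠ f 2 := hf.ne (by decide)
  have h02 : f 0 ≠ f 2 := hf.ne (by decide)
  have e : (CoxeterMatrix.B n).M.submatrix f f =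
      !![1, CoxeterMatrix.B n (f 0) (f 1), CoxeterMatrix.B n (f 0) (f 2);
        CoxeterMatrix.B n (f 0) (f 1), 1, CoxeterMatrix.B n (f 1) (f 2);
        CoxeterMatrix.B n (f 0) (f 2), CoxeterMatrix.B n (f 1) (f 2), 1] := by
    have h10 := (CoxeterMatrix.B n).symmetric (f 1) (f 0)
    have h20 := (CoxeterMatrix.B n).symmetric (f 2) (f 0)
    have h21 := (CoxeterMatrix.B n).symmetric (f 2) (f 1)
    ext i j
    fin_cases i <;> fin_cases j <;> simp [h10, h20, h21]
  rw [e]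
  rcases B_apply_cases h01 with ⟨e1, g1⟩ | ⟨e1, g1⟩ | ⟨e1, g1⟩ <;>
  rcases B_apply_cases h12 with ⟨e2, g2⟩ | ⟨e2, g2⟩ | ⟨e2, g2⟩ <;>
  rcases B_apply_cases h02 with ⟨e3, g3⟩ | ⟨e3, g3⟩ | ⟨e3, g3⟩ <;>
  rw [e1, e2, e3] <;>
  first
  | (exfalso; have := Fin.val_ne_of_ne h01; have := Fin.val_ne_of_ne h12
     have := Fin.val_ne_of_ne h02; omega)
  | exact ⟨_, _, _, rfl, rfl, rfl⟩

end CoxeterMatrix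

/-! ### The central element in type B -/

namespace ArtinMonoid

/-- The set of generators that divide a central element is closed under passing to adjacent
vertices: if `a = s b`, then `s ∣ t a`, so `t a` is a multiple of the lcm `t s t ⋯`; hence
`a = s t c` for some `c`, and conjugating by `s` gives `a = t c s`. -/
theorem dvd_of_commute_of_dvd {S : Type*} [DecidableEq S] {M : CoxeterMatrix S}
    (hM : ∀ s t, M s t ≠ 0)
    (hcube : ∀ f : Fin 3 → S, Function.Injective f → CubeCondition (M.M.submatrix f f))
    {a : ArtinMonoid M} (ha : ∀ b, a * b = b * a) {s t : S} (hst : 3 ≤ M s t)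
    (h : gen M s ∣ a) : gen M t ∣ a := by
  obtain ⟨b, rfl⟩ := h
  have hne : s ≠ t := by
    rintro rfl
    simp at hst
  have h1 : gen M t * (gen M s * b) = gen M s * (b * gen M t) := by
    rw [← ha, mul_assoc]
  obtain ⟨c, hc, -⟩ := exists_of_gen_mul_eq hM hcube h1
  obtain ⟨m, hm⟩ := Nat.exists_eq_add_of_le' hst
  have h2 : letterCompl M.M t s = s :: t :: altWord s t m := by
    simp [letterCompl, hne.symm, M.symmetric t s, hm, altWord]
  rw [h2, eval_cons, eval_cons] at hc
  have h3 := ha (gen M s)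
  nth_rw 1 [hc] at h3
  rw [mul_assoc, mul_assoc] at h3
  exact ⟨eval M (altWord s t m) * (c * gen M s),
    (mul_left_cancel_of_cube hM hcube h3).symm.trans (mul_assoc _ _ _)⟩

section TypeB

variable {n : ℕ}

theorem mul_left_cancel_B {a b c : ArtinMonoid (CoxeterMatrix.B n)} (h : a * b = a * c) : b = c :=
  mul_left_cancel_of_cube (CoxeterMatrix.B_ne_zero n) CoxeterMatrix.cubeCondition_B h

/-- The generators of the Artin monoid of type `B_n`, numbered from the end of the Coxeter graph
that carries the label `4`. They are continued by `1` for indices `k ≥ n`. -/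
def genB (n k : ℕ) : ArtinMonoid (CoxeterMatrix.B n) :=
  if h : k < n then gen _ ⟨n - 1 - k, by omega⟩ else 1

theorem genB_of_lt {k : ℕ} (h : k < n) :
    genB n k = gen (CoxeterMatrix.B n) ⟨n - 1 - k, by omega⟩ := dif_pos h

theorem gen_eq_genB (i : Fin n) : gen (CoxeterMatrix.B n) i = genB n (n - 1 - i) := by
  have := i.2
  rw [genB_of_lt (by omega)]
  congr 1
  ext
  simp only
  omega

theorem B_apply_far {i j : ℕ} (hi : i < n) (hj : j < n) (hij : i + 2 ≤ j) :
    CoxeterMatrix.B n ⟨n - 1 - j, by omega⟩ ⟨n - 1 - i, by omega⟩ = 2 := by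
  rcases CoxeterMatrix.B_apply_cases (n := n) (i := ⟨n - 1 - j, by omega⟩)
    (j := ⟨n - 1 - i, by omega⟩) (by simp; omega) with h | h | h <;> dsimp only at h <;> omega

theorem B_apply_three {k : ℕ} (h : k + 2 < n) :
    CoxeterMatrix.B n ⟨n - 1 - (k + 2), by omega⟩ ⟨n - 1 - (k + 1), by omega⟩ = 3 := by
  rcases CoxeterMatrix.B_apply_cases (n := n) (i := ⟨n - 1 - (k + 2), by omega⟩)
    (j := ⟨n - 1 - (k + 1), by omega⟩) (by simp; omega) with h | h | h <;> dsimp only at h <;> omega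

theorem B_apply_four (h : 1 < n) :
    CoxeterMatrix.B n ⟨n - 1 - 1, by omega⟩ ⟨n - 1 - 0, by omega⟩ = 4 := by
  rcases CoxeterMatrix.B_apply_cases (n := n) (i := ⟨n - 1 - 1, by omega⟩)
    (j := ⟨n - 1 - 0, by omega⟩) (by simp; omega) with h | h | h <;> dsimp only at h <;> omega

theorem genB_commute {i j : ℕ} (hij : i + 2 ≤ j) : Commute (genB n j) (genB n i) := by
  by_cases hj : j < n
  · have hi : i < n := by omega
    have := altProd_gen (M := CoxeterMatrix.B n) ⟨n - 1 - j, by omega⟩ ⟨n - 1 - i, by omega⟩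
    rw [B_apply_far hi hj hij] at this
    rw [genB_of_lt hi, genB_of_lt hj]
    simpa [altProd, Commute, SemiconjBy] using this
  · rw [genB, dif_neg hj]
    exact Commute.one_left _

theorem genB_braid {k : ℕ} (h : k + 2 < n) : genB n (k + 2) * genB n (k + 1) * genB n (k + 2) =
    genB n (k + 1) * genB n (k + 2) * genB n (k + 1) := by
  have := altProd_gen (M := CoxeterMatrix.B n) ⟨n - 1 - (k + 2), by omega⟩
    ⟨n - 1 - (k + 1), by omega⟩
  rw [B_apply_three h] at this
  rw [genB_of_lt h, genB_of_lt (show k + 1 < n by omega)]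
  simpa [altProd, mul_assoc] using this

theorem genB_four (h : 1 < n) : genB n 1 * genB n 0 * genB n 1 * genB n 0 =
    genB n 0 * genB n 1 * genB n 0 * genB n 1 := by
  have := altProd_gen (M := CoxeterMatrix.B n) ⟨n - 1 - 1, by omega⟩ ⟨n - 1 - 0, by omega⟩
  rw [B_apply_four h] at this
  rw [genB_of_lt h, genB_of_lt (show 0 < n by omega)]
  simpa [altProd, mul_assoc] using this

theorem exists_of_genB_eq_far {i j : ℕ} (hj : j < n) (hij : i + 2 ≤ j)
    {a b : ArtinMonoid (CoxeterMatrix.B n)} (h : genB n j * a = genB n i * b) :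
    ∃ c, a = genB n i * c ∧ b = genB n j * c := by
  have hi : i < n := by omega
  rw [genB_of_lt hi, genB_of_lt hj] at h
  obtain ⟨c, h1, h2⟩ := exists_of_gen_mul_eq (CoxeterMatrix.B_ne_zero n)
    CoxeterMatrix.cubeCondition_B h
  have hne : n - 1 - j ≠ n - 1 - i := by omega
  refine ⟨c, h1.trans ?_, h2.trans ?_⟩
  · rw [genB_of_lt hi]; simp [letterCompl, hne, B_apply_far hi hj hij, altWord]
  · rw [genB_of_lt hj, letterCompl, CoxeterMatrix.symmetric, B_apply_far hi hj hij]
    simp [hne.symm, altWord]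

theorem exists_of_genB_eq_three {k : ℕ} (hk : k + 2 < n)
    {a b : ArtinMonoid (CoxeterMatrix.B n)} (h : genB n (k + 2) * a = genB n (k + 1) * b) :
    ∃ c, a = genB n (k + 1) * (genB n (k + 2) * c) ∧
      b = genB n (k + 2) * (genB n (k + 1) * c) := by
  have hi : k + 1 < n := by omega
  rw [genB_of_lt hi, genB_of_lt hk] at h
  obtain ⟨c, h1, h2⟩ := exists_of_gen_mul_eq (CoxeterMatrix.B_ne_zero n)
    CoxeterMatrix.cubeCondition_B h
  have hne : n - 1 - (k + 2) ≠ n - 1 - (k + 1) := by omega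
  refine ⟨c, h1.trans ?_, h2.trans ?_⟩
  · rw [genB_of_lt hi, genB_of_lt hk, letterCompl, B_apply_three hk]
    simp [hne, altWord, mul_assoc]
  · rw [genB_of_lt hi, genB_of_lt hk, letterCompl, CoxeterMatrix.symmetric, B_apply_three hk]
    simp [hne.symm, altWord, mul_assoc]

theorem exists_of_genB_eq_four (hn : 1 < n)
    {a b : ArtinMonoid (CoxeterMatrix.B n)} (h : genB n 1 * a = genB n 0 * b) :
    ∃ c, b = genB n 1 * genB n 0 * genB n 1 * c := by
  have hi : 0 < n := by omega
  rw [genB_of_lt hi, genB_of_lt hn] at h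
  obtain ⟨c, -, h2⟩ := exists_of_gen_mul_eq (CoxeterMatrix.B_ne_zero n)
    CoxeterMatrix.cubeCondition_B h
  have hne : n - 1 - 1 ≠ n - 1 - 0 := by omega
  refine ⟨c, h2.trans ?_⟩
  rw [genB_of_lt hi, genB_of_lt hn, letterCompl, CoxeterMatrix.symmetric, B_apply_four hn]
  simp only [Fin.mk.injEq, hne.symm, if_false]
  simp [altWord, mul_assoc]

/-- The palindromes `t_k ⋯ t_1 t_0 t_1 ⋯ t_k`, where `t_i = genB n i`. They commute pairwise, and
their product is the central Garside element. -/
def palindromeB (n : ℕ) : ℕ → ArtinMonoid (CoxeterMatrix.B n)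
  | 0 => genB n 0
  | k + 1 => genB n (k + 1) * palindromeB n k * genB n (k + 1)

/-- The product of the palindromes with index at most `k`; it is the lcm of the generators
`genB n i` with `i ≤ k`. -/
def garsideB (n : ℕ) : ℕ → ArtinMonoid (CoxeterMatrix.B n)
  | 0 => palindromeB n 0
  | k + 1 => garsideB n k * palindromeB n (k + 1)

theorem genB_commute_palindromeB {j k : ℕ} (h : k + 2 ≤ j) :
    Commute (genB n j) (palindromeB n k) := by
  induction k with
  | zero => exact genB_commute h
  | succ k ih =>
    have h1 : Commute (genB n j) (genB n (k + 1)) := genB_commute h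
    exact (h1.mul_right (ih (by omega))).mul_right h1

theorem genB_commute_palindromeB_of_lt {j k : ℕ} (hk : k < n) (h : j < k) :
    Commute (genB n j) (palindromeB n k) := by
  induction k with
  | zero => omega
  | succ k ih =>
    rcases Nat.lt_succ_iff_lt_or_eq.1 h with h | rfl
    · have h1 : Commute (genB n j) (genB n (k + 1)) := (genB_commute (by omega)).symm
      exact (h1.mul_right (ih (by omega) h)).mul_right h1
    · rcases j with _ | j
      · have := genB_four hk
        simp only [mul_assoc] at this
        simpa only [Commute, SemiconjBy, palindromeB, zero_add, mul_assoc] using this.symm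
      · have hb := genB_braid hk
        have hc : Commute (genB n (j + 2)) (palindromeB n j) := genB_commute_palindromeB le_rfl
        simp only [palindromeB, Commute, SemiconjBy]
        calc _ = genB n (j + 1) * genB n (j + 2) * genB n (j + 1) * palindromeB n j
                * genB n (j + 1) * genB n (j + 2) := by simp only [mul_assoc]
          _ = genB n (j + 2) * genB n (j + 1) * (genB n (j + 2) * palindromeB n j)
                * genB n (j + 1) * genB n (j + 2) := by rw [← hb]; simp only [mul_assoc]
          _ = genB n (j + 2) * genB n (j + 1) * palindromeB n j
                * (genB n (j + 2) * genB n (j + 1) * genB n (j + 2)) := by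
              rw [hc.eq]; simp only [mul_assoc]
          _ = _ := by rw [hb]; simp only [mul_assoc]

theorem palindromeB_commute_succ {k : ℕ} (hk : k + 1 < n) :
    Commute (palindromeB n k) (palindromeB n (k + 1)) := by
  induction k with
  | zero =>
    have := genB_four hk
    simp only [mul_assoc] at this
    simpa only [Commute, SemiconjBy, palindromeB, zero_add, mul_assoc] using this.symm
  | succ k ih =>
    have hb := genB_braid hk
    have hc : Commute (genB n (k + 2)) (palindromeB n k) := genB_commute_palindromeB le_rfl
    have ih := (ih (by omega)).eq
    rw [palindromeB] at ih
    simp only [palindromeB, Commute, SemiconjBy]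
    generalize genB n (k + 1) = s at *
    generalize genB n (k + 2) = t at *
    generalize palindromeB n k = x at *
    calc _ = s * x * (s * t * s) * x * s * t := by simp only [mul_assoc]
      _ = s * (x * t) * s * (t * x) * s * t := by rw [← hb]; simp only [mul_assoc]
      _ = s * (t * x) * s * x * (t * s * t) := by rw [hc.eq]; simp only [mul_assoc]
      _ = s * t * (x * (s * x * s)) * t * s := by rw [hb]; simp only [mul_assoc]
      _ = s * t * s * x * s * x * t * s := by rw [ih]; simp only [mul_assoc]
      _ = t * s * (t * x) * s * x * t * s := by rw [← hb]; simp only [mul_assoc]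
      _ = t * s * x * (t * s * (x * t)) * s := by rw [hc.eq]; simp only [mul_assoc]
      _ = t * s * x * (t * s * t) * x * s := by rw [← hc.eq]; simp only [mul_assoc]
      _ = _ := by rw [hb]; simp only [mul_assoc]

theorem genB_commute_garsideB {j k : ℕ} (h : k + 2 ≤ j) :
    Commute (genB n j) (garsideB n k) := by
  induction k with
  | zero => exact genB_commute_palindromeB h
  | succ k ih => exact (ih (by omega)).mul_right (genB_commute_palindromeB h)

theorem genB_commute_garsideB_of_le {j k : ℕ} (hk : k < n) (h : j ≤ k) :
    Commute (genB n j) (garsideB n k) := by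
  induction k with
  | zero => rw [Nat.le_zero.1 h]; exact Commute.refl _
  | succ k ih =>
    rcases Nat.le_succ_iff.1 h with h | rfl
    · exact (ih (by omega) h).mul_right (genB_commute_palindromeB_of_lt hk (by omega))
    · have h1 : Commute (genB n (k + 1)) (palindromeB n k * palindromeB n (k + 1)) := by
        have := (palindromeB_commute_succ hk).eq
        simp only [Commute, SemiconjBy]
        nth_rw 2 [this]
        simp only [palindromeB, mul_assoc]
      rcases k with _ | k
      · exact h1
      · rw [garsideB, garsideB, mul_assoc]
        exact (genB_commute_garsideB le_rfl).mul_right h1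

theorem garsideB_central (hn : 0 < n) (a : ArtinMonoid (CoxeterMatrix.B n)) :
    garsideB n (n - 1) * a = a * garsideB n (n - 1) := by
  obtain ⟨l, rfl⟩ := exists_eval a
  induction l with
  | nil => simp
  | cons i l ih =>
    have := genB_commute_garsideB_of_le (n := n) (j := n - 1 - i) (k := n - 1) (by omega) (by omega)
    rw [← gen_eq_genB] at this
    rw [eval_cons, ← mul_assoc, ← this.eq, mul_assoc, ih, mul_assoc]

theorem garsideB_length_ne_zero (hn : 0 < n) (k : ℕ) : length (garsideB n k) ≠ 0 := by
  induction k with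
  | zero => simp [garsideB, palindromeB, genB_of_lt hn]
  | succ k ih => simp [garsideB, ih]

theorem genB_dvd_of_dvd_palindromeB_mul {j k : ℕ} (hj : j < n) (h : k + 2 ≤ j)
    {c : ArtinMonoid (CoxeterMatrix.B n)} (hc : genB n j ∣ palindromeB n k * c) :
    genB n j ∣ c := by
  have key : ∀ {i : ℕ} {c : ArtinMonoid (CoxeterMatrix.B n)}, i + 2 ≤ j →
      genB n j ∣ genB n i * c → genB n j ∣ c := by
    rintro i c hi ⟨e, he⟩
    obtain ⟨d, -, hd⟩ := exists_of_genB_eq_far hj hi he.symm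
    exact ⟨d, hd⟩
  induction k generalizing c with
  | zero => exact key h hc
  | succ k ih =>
    rw [palindromeB, mul_assoc, mul_assoc] at hc
    exact key h (ih (by omega) (key h hc))

theorem genB_dvd_of_dvd_garsideB_mul {j k : ℕ} (hj : j < n) (h : k + 2 ≤ j)
    {c : ArtinMonoid (CoxeterMatrix.B n)} (hc : genB n j ∣ garsideB n k * c) :
    genB n j ∣ c := by
  induction k generalizing c with
  | zero => exact genB_dvd_of_dvd_palindromeB_mul hj h hc
  | succ k ih =>
    rw [garsideB, mul_assoc] at hc
    exact genB_dvd_of_dvd_palindromeB_mul hj h (ih (by omega) hc)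

/-- The lcm of `t_{k+1}` and the `k`-th palindrome `x_k` is `x_k x_{k+1}`. -/
theorem palindromeB_succ_dvd {k : ℕ} (hk : k + 1 < n) {c : ArtinMonoid (CoxeterMatrix.B n)}
    (h : genB n (k + 1) ∣ palindromeB n k * c) : palindromeB n (k + 1) ∣ c := by
  induction k generalizing c with
  | zero =>
    obtain ⟨e, he⟩ := h
    obtain ⟨d, hd⟩ := exists_of_genB_eq_four hk he.symm
    exact ⟨d, by simpa [palindromeB] using hd⟩
  | succ k ih =>
    have ih := fun {c} => ih (c := c) (by omega)
    obtain ⟨e, he⟩ := h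
    have hc : Commute (genB n (k + 2)) (palindromeB n k) := genB_commute_palindromeB le_rfl
    have hdvd := fun {c} => genB_dvd_of_dvd_palindromeB_mul (c := c) hk (le_refl (k + 2))
    have hlcm := fun {a b} => exists_of_genB_eq_three (a := a) (b := b) hk
    rw [palindromeB, mul_assoc, mul_assoc] at he
    rw [palindromeB] at ih
    rw [palindromeB, palindromeB]
    generalize genB n (k + 1) = t at *
    simp only [add_assoc, one_add_one_eq_two] at *
    generalize genB n (k + 2) = s at *
    generalize palindromeB n k = x at *
    obtain ⟨e', -, he'⟩ := hlcm he.symm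
    obtain ⟨c₁, hc₁⟩ := hdvd ⟨_, he'⟩
    obtain ⟨c₂, rfl, rfl⟩ := hlcm hc₁.symm
    rw [hc₁, ← mul_assoc, ← hc.eq, mul_assoc] at he'
    obtain ⟨w, hw⟩ := ih ⟨_, mul_left_cancel_B he'⟩
    rw [mul_assoc, mul_assoc] at hw
    have hw := mul_left_cancel_B hw
    obtain ⟨w₁, hw₁⟩ := hdvd ⟨_, hw.symm⟩
    obtain ⟨w₂, rfl, rfl⟩ := hlcm hw₁.symm
    rw [hw₁, ← mul_assoc, ← hc.eq, mul_assoc] at hw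
    rw [mul_left_cancel_B hw]
    exact ⟨w₂, by simp only [mul_assoc]⟩

theorem garsideB_dvd {k : ℕ} (hk : k < n) {a : ArtinMonoid (CoxeterMatrix.B n)}
    (h : ∀ j ≤ k, genB n j ∣ a) : garsideB n k ∣ a := by
  induction k with
  | zero => exact h 0 le_rfl
  | succ k ih =>
    obtain ⟨c, rfl⟩ := ih (by omega) fun j hj => h j (by omega)
    have h1 : palindromeB n (k + 1) ∣ c := by
      refine palindromeB_succ_dvd hk ?_
      have h2 := h (k + 1) le_rfl
      rcases k with _ | k
      · exact h2
      · rw [garsideB, mul_assoc] at h2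
        exact genB_dvd_of_dvd_garsideB_mul hk le_rfl h2
    rw [garsideB]
    exact mul_dvd_mul_left _ h1

/-- As the Coxeter graph is connected, every generator divides a central element other than `1`. -/
theorem genB_dvd_of_central {a : ArtinMonoid (CoxeterMatrix.B n)}
    (ha : ∀ b, a * b = b * a) (h1 : a ≠ 1) {j : ℕ} (hj : j < n) : genB n j ∣ a := by
  have step : ∀ k, k + 1 < n → (genB n k ∣ a ↔ genB n (k + 1) ∣ a) := by
    intro k hk
    have hk' : k < n := by omega
    have h3 : 3 ≤ CoxeterMatrix.B n ⟨n - 1 - (k + 1), by omega⟩ ⟨n - 1 - k, by omega⟩ := by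
      rcases k with _ | k
      · rw [B_apply_four hk]; omega
      · rw [B_apply_three hk]
    rw [genB_of_lt hk, genB_of_lt hk']
    constructor
    · exact dvd_of_commute_of_dvd (CoxeterMatrix.B_ne_zero n) CoxeterMatrix.cubeCondition_B ha
        (by rw [CoxeterMatrix.symmetric]; exact h3)
    · exact dvd_of_commute_of_dvd (CoxeterMatrix.B_ne_zero n) CoxeterMatrix.cubeCondition_B ha h3
  have all : ∀ k, k < n → (genB n k ∣ a ↔ genB n 0 ∣ a) := by
    intro k
    induction k with
    | zero => intro; rfl
    | succ k ih => intro hk; rw [← step k hk, ih (by omega)]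
  obtain ⟨i, b, rfl⟩ := exists_eq_gen_mul h1
  rw [all j hj, ← all (n - 1 - i) (by omega), ← gen_eq_genB]
  exact ⟨b, rfl⟩

theorem central_eq_pow (hn : 0 < n) {a : ArtinMonoid (CoxeterMatrix.B n)}
    (ha : ∀ b, a * b = b * a) : ∃ k, a = garsideB n (n - 1) ^ k := by
  induction hl : length a using Nat.strong_induction_on generalizing a with
  | _ l ih =>
    by_cases h1 : a = 1
    · exact ⟨0, by rw [h1, pow_zero]⟩
    obtain ⟨c, rfl⟩ := garsideB_dvd (n := n) (k := n - 1) (by omega) fun j hj =>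
      genB_dvd_of_central ha h1 (show j < n by omega)
    have hc : ∀ b, c * b = b * c := by
      intro b
      apply mul_left_cancel_B (a := garsideB n (n - 1))
      rw [← mul_assoc, ha, ← mul_assoc, ← mul_assoc, garsideB_central hn b]
    have := garsideB_length_ne_zero hn (n - 1)
    rw [length_mul] at hl
    obtain ⟨k, hk⟩ := ih _ (by omega) hc rfl
    exact ⟨k + 1, by rw [pow_succ', ← hk]⟩

end TypeB

end ArtinMonoid

/-! ### The Artin group of type B -/

namespace ArtinGroup

variable {S : Type*} {M : CoxeterMatrix S}

theorem altProd_of (s t : S) :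
    altProd (PresentedGroup.of s : ArtinGroup M) (PresentedGroup.of t) (M s t) =
      altProd (PresentedGroup.of t) (PresentedGroup.of s) (M s t) := by
  rcases eq_or_ne s t with rfl | h
  · rfl
  by_cases h0 : M s t = 0
  · rw [h0]; rfl
  have := PresentedGroup.one_of_mem (rels := artinRelations M) ⟨s, t, h, h0, rfl⟩
  rw [map_mul, map_inv, mul_inv_eq_one, map_altProd, map_altProd] at this
  exact this

/-- The homomorphism out of an Artin group given by elements that satisfy the Artin relations. -/
def lift {G : Type*} [Group G] (f : S → G)
    (hf : ∀ s t, s ≠ t → altProd (f s) (f t) (M s t) = altProd (f t) (f s) (M s t)) :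
    ArtinGroup M →* G :=
  PresentedGroup.toGroup (f := f) (by
    rintro _ ⟨s, t, h, -, rfl⟩
    rw [map_mul, map_inv, mul_inv_eq_one, map_altProd, map_altProd, FreeGroup.lift_apply_of,
      FreeGroup.lift_apply_of, hf s t h])

@[simp] theorem lift_of {G : Type*} [Group G] (f : S → G)
    (hf : ∀ s t, s ≠ t → altProd (f s) (f t) (M s t) = altProd (f t) (f s) (M s t)) (s : S) :
    lift (M := M) f hf (PresentedGroup.of s) = f s :=
  PresentedGroup.toGroup.of _

/-- The canonical homomorphism from the Artin monoid to the Artin group. -/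
def ofMonoid (M : CoxeterMatrix S) : ArtinMonoid M →* ArtinGroup M :=
  PresentedMonoid.lift (fun s => PresentedGroup.of s) (by
    rintro _ _ ⟨s, t, -, -, rfl, rfl⟩
    rw [map_altProd, map_altProd, FreeMonoid.lift_eval_of, FreeMonoid.lift_eval_of, altProd_of])

@[simp] theorem ofMonoid_gen (s : S) :
    ofMonoid M (ArtinMonoid.gen M s) = PresentedGroup.of s := rfl

/-- The Artin monoid embeds into the Artin group if its generators are left cancellable and divide a
central left cancellable element: the group then maps to the
localization at the powers of this element. -/
theorem ofMonoid_injective {z : ArtinMonoid M} (hz : ∀ a, z * a = a * z)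
    (hcancel : ∀ {a b : ArtinMonoid M}, z * a = z * b → a = b)
    (hgen : ∀ a b : ArtinMonoid M, ∀ s, ArtinMonoid.gen M s * a = ArtinMonoid.gen M s * b → a = b)
    (hdvd : ∀ s, ArtinMonoid.gen M s ∣ z) : Function.Injective (ofMonoid M) := by
  have hpow : ∀ (c : Submonoid.powers z) (a : ArtinMonoid M), (c : ArtinMonoid M) * a = a * c := by
    rintro ⟨_, k, rfl⟩ a
    exact (Commute.pow_left (show Commute z a from hz a) k).eq
  have hpow' : ∀ (c : Submonoid.powers z) {a b : ArtinMonoid M},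
      (c : ArtinMonoid M) * a = c * b → a = b := by
    rintro ⟨_, k, rfl⟩ a b h
    induction k with
    | zero => simpa using h
    | succ k ih =>
      simp only [pow_succ', mul_assoc] at h
      exact ih (hcancel h)
  let _ : OreLocalization.OreSet (Submonoid.powers z) :=
    { ore_right_cancel := fun a b c h => ⟨1, by
        rw [hpow' c ((hpow c a).trans (h.trans (hpow c b).symm))]⟩
      oreNum := fun r _ => r
      oreDenom := fun _ s => s
      ore_eq := fun r s => hpow s r }
  let ι : ArtinMonoid M →* OreLocalization (Submonoid.powers z) (ArtinMonoid M) :=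
    OreLocalization.numeratorHom
  have hι : Function.Injective ι := by
    intro a b h
    simp only [ι, OreLocalization.numeratorHom_apply, OreLocalization.oreDiv_eq_iff] at h
    obtain ⟨u, v, h1, h2⟩ := h
    have h2 : (u : ArtinMonoid M) = v := by simpa using h2
    rw [Submonoid.smul_def, smul_eq_mul, smul_eq_mul, ← h2] at h1
    exact (hpow' u h1).symm
  have hunit : ∀ s, IsUnit (ι (ArtinMonoid.gen M s)) := by
    intro s
    obtain ⟨u, hu⟩ := hdvd s
    have hu' : z = u * ArtinMonoid.gen M s := by
      apply hgen _ _ s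
      rw [← mul_assoc, ← hu, hz]
    have h1 : IsUnit (ι z) := OreLocalization.numerator_isUnit
      (⟨z, Submonoid.mem_powers z⟩ : Submonoid.powers z)
    obtain ⟨w, hw⟩ := h1
    have e1 : ι (ArtinMonoid.gen M s) * (ι u * ↑w⁻¹) = 1 := by
      rw [← mul_assoc, ← map_mul, ← hu, ← hw, Units.mul_inv]
    have e2 : (↑w⁻¹ * ι u) * ι (ArtinMonoid.gen M s) = 1 := by
      rw [mul_assoc, ← map_mul, ← hu', ← hw, Units.inv_mul]
    exact isUnit_iff_exists.2 ⟨_, e1, by rwa [← left_inv_eq_right_inv e2 e1]⟩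
  choose f hf using hunit
  let ψ : ArtinGroup M →* (OreLocalization (Submonoid.powers z) (ArtinMonoid M))ˣ :=
    lift f (by
      intro s t _
      ext
      have := congrArg ι (ArtinMonoid.altProd_gen (M := M) s t)
      rw [map_altProd, map_altProd, ← hf, ← hf] at this
      simpa only [← Units.coeHom_apply, map_altProd] using this)
  have hψ : ∀ a, (ψ (ofMonoid M a) : OreLocalization (Submonoid.powers z) (ArtinMonoid M)) =
      ι a := by
    intro a
    obtain ⟨l, rfl⟩ := ArtinMonoid.exists_eval a
    induction l with
    | nil => simp
    | cons s l ih => rw [ArtinMonoid.eval_cons, map_mul, map_mul, Units.val_mul, ih, map_mul,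
        ofMonoid_gen, lift_of, hf]
  intro a b h
  exact hι (by rw [← hψ a, ← hψ b, h])

/-- The homomorphism from an Artin group to `ℤ` that sends every generator to `1`. -/
def lengthHom (M : CoxeterMatrix S) : ArtinGroup M →* Multiplicative ℤ :=
  lift (fun _ => Multiplicative.ofAdd 1) (fun _ _ _ => rfl)

theorem lengthHom_ofMonoid (a : ArtinMonoid M) :
    lengthHom M (ofMonoid M a) = Multiplicative.ofAdd (a.length : ℤ) := by
  obtain ⟨l, rfl⟩ := ArtinMonoid.exists_eval a
  induction l with
  | nil => simp
  | cons s l ih =>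
    rw [ArtinMonoid.eval_cons, map_mul, map_mul, ih, ofMonoid_gen, lengthHom, lift_of,
      ← ofAdd_add]
    simp

end ArtinGroup

open ArtinMonoid ArtinGroup

/-- The center of `A[B_n]` is generated by an element of positive length, so it contains no
nontrivial element of length zero; in particular it meets the commutator subgroup trivially. -/
theorem eq_one_of_mem_center_of_lengthHom_eq_one {n : ℕ} (hn : 0 < n) {g : ArtinB n}
    (hg : g ∈ Subgroup.center (ArtinB n)) (hlen : ArtinGroup.lengthHom (CoxeterMatrix.B n) g = 1) :
    g = 1 := by
  set z := garsideB n (n - 1) with hz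
  have hz1 : z ≠ 1 := by
    intro h
    have := garsideB_length_ne_zero hn (n - 1)
    rw [← hz, h, length_one] at this
    exact this rfl
  have hzc : ∀ a, z * a = a * z := garsideB_central hn
  have hdvd : ∀ i, gen (CoxeterMatrix.B n) i ∣ z := fun i => by
    rw [gen_eq_genB]
    exact genB_dvd_of_central hzc hz1 (by omega)
  have hinj : Function.Injective (ofMonoid (CoxeterMatrix.B n)) :=
    ofMonoid_injective hzc mul_left_cancel_B (fun _ _ _ => mul_left_cancel_B) hdvd
  set Z := ofMonoid (CoxeterMatrix.B n) z with hZ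
  have hgen : ∀ {x : ArtinB n}, (∀ i, x * PresentedGroup.of i = PresentedGroup.of i * x) →
      ∀ y, x * y = y * x := by
    intro x hx y
    have : Subgroup.centralizer {x} = (⊤ : Subgroup (ArtinB n)) := by
      rw [Subgroup.eq_top_iff']
      intro y
      refine PresentedGroup.generated_by _ _ (fun i => ?_) y
      rw [Subgroup.mem_centralizer_singleton_iff]
      exact (hx i).symm
    have hy : y ∈ Subgroup.centralizer {x} := this ▸ Subgroup.mem_top y
    exact (Subgroup.mem_centralizer_singleton_iff.1 hy).symm
  have hZc : ∀ y, Z * y = y * Z := hgen fun i => by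
    rw [← ofMonoid_gen, hZ, ← map_mul, hzc, map_mul]
  -- Every element is a fraction with a power of `Z` as its denominator.
  have hfrac : ∀ x : ArtinB n, ∃ a k, x * Z ^ k = ofMonoid (CoxeterMatrix.B n) a := by
    have hgenc : ∀ x ∈ Subgroup.closure
        (Set.range (PresentedGroup.of : Fin n → ArtinB n)),
        ∃ a, ∃ k : ℕ, x * Z ^ k = ofMonoid (CoxeterMatrix.B n) a := by
      intro x hx
      induction hx using Subgroup.closure_induction'' with
      | one => exact ⟨1, 0, by simp⟩
      | mem _ h =>
        obtain ⟨i, rfl⟩ := h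
        exact ⟨gen _ i, 0, by simp⟩
      | inv_mem _ h =>
        obtain ⟨i, rfl⟩ := h
        obtain ⟨u, hu⟩ := hdvd i
        refine ⟨u, 1, ?_⟩
        rw [pow_one, hZ, hu, map_mul, ofMonoid_gen, inv_mul_cancel_left]
      | mul x y _ _ hx hy =>
        obtain ⟨a, k, ha⟩ := hx
        obtain ⟨b, m, hb⟩ := hy
        refine ⟨a * b, k + m, ?_⟩
        have : Commute (Z ^ k) y := Commute.pow_left (hZc y) k
        rw [map_mul, ← ha, ← hb, pow_add]
        calc _ = x * (y * Z ^ k) * Z ^ m := by simp only [mul_assoc]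
          _ = _ := by rw [← this.eq]; simp only [mul_assoc]
    intro x
    exact hgenc x (by rw [PresentedGroup.closure_range_of]; exact Subgroup.mem_top x)
  obtain ⟨a, k, ha⟩ := hfrac g
  have hac : ∀ b, a * b = b * a := by
    intro b
    apply hinj
    have h1 : Commute (Z ^ k) (ofMonoid (CoxeterMatrix.B n) b) := Commute.pow_left (hZc _) k
    have h2 : Commute g (ofMonoid (CoxeterMatrix.B n) b) :=
      (Subgroup.mem_center_iff.1 hg _).symm
    rw [map_mul, map_mul, ← ha]
    exact (h2.mul_left h1).eq
  obtain ⟨m, rfl⟩ := central_eq_pow hn hac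
  rw [map_pow, ← hz, ← hZ] at ha
  have hl := congrArg (ArtinGroup.lengthHom (CoxeterMatrix.B n)) ha
  rw [map_mul, hlen, one_mul, map_pow, map_pow, hZ, lengthHom_ofMonoid, ← ofAdd_nsmul,
    ← ofAdd_nsmul] at hl
  have hl' := Multiplicative.ofAdd.injective hl
  have hne := garsideB_length_ne_zero hn (n - 1)
  rw [← hz] at hne
  simp only [nsmul_eq_mul, mul_eq_mul_right_iff, Nat.cast_inj, Nat.cast_eq_zero, hne,
    or_false] at hl'
  rwa [hl', mul_eq_right] at ha

/-! ### Lifting endomorphisms -/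

/-- A sequence can be changed by central elements, so that all braid relations between consecutive
terms that hold modulo the center hold exactly: if `a b a = b a b c` with `c` central, then `b c`
satisfies the braid relation with `a`. -/
theorem exists_braid_lift {G Q : Type*} [Group G] [Group Q] (π : G →* Q)
    (hπ : π.ker ≤ Subgroup.center G) (x : ℕ → G) :
    ∃ y : ℕ → G, (∀ i, π (y i) = π (x i)) ∧
      ∀ i, π (y i * y (i + 1) * y i) = π (y (i + 1) * y i * y (i + 1)) →
        y i * y (i + 1) * y i = y (i + 1) * y i * y (i + 1) := by
  have step : ∀ (i : ℕ) (a : G), ∃ b, π b = π (x (i + 1)) ∧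
      (π (a * b * a) = π (b * a * b) → a * b * a = b * a * b) := by
    intro i a
    by_cases h : π (a * x (i + 1) * a) = π (x (i + 1) * a * x (i + 1))
    · generalize x (i + 1) = b at *
      set c := (b * a * b)⁻¹ * (a * b * a) with hc
      have hck : c ∈ π.ker := by
        rw [MonoidHom.mem_ker, hc, map_mul, map_inv, h, inv_mul_cancel]
      have hcomm : ∀ g, g * c = c * g := Subgroup.mem_center_iff.1 (hπ hck)
      refine ⟨b * c, ?_, fun _ => ?_⟩
      · rw [map_mul, MonoidHom.mem_ker.1 hck, mul_one]
      · have e : a * b * a = b * a * b * c := by rw [hc, mul_inv_cancel_left]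
        calc a * (b * c) * a = a * b * (c * a) := by simp only [mul_assoc]
          _ = a * b * a * c := by rw [← hcomm a]; simp only [mul_assoc]
          _ = b * a * (b * c) * c := by rw [e]; simp only [mul_assoc]
          _ = b * (a * c) * (b * c) := by
              rw [mul_assoc (b * a), hcomm (b * c)]; simp only [mul_assoc]
          _ = b * c * a * (b * c) := by rw [hcomm a]; simp only [mul_assoc]
    · refine ⟨x (i + 1), rfl, fun h' => absurd h' h⟩
  choose F hF1 hF2 using step
  let y : ℕ → G := fun i => Nat.rec (x 0) F i
  refine ⟨y, fun i => ?_, fun i => hF2 i (y i)⟩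
  cases i with
  | zero => rfl
  | succ i => exact hF1 i (y i)

theorem proposition2p7 (n : ℕ) (hn : 5 ≤ n) (φ : ModCenter (ArtinB n) →* ModCenter (ArtinB n)) :
    ∃ f : ArtinB n →* ArtinB n, IsLift f φ := by
  set π := modCenterProj (ArtinB n) with hπ
  have hker : π.ker = Subgroup.center (ArtinB n) := QuotientGroup.ker_mk' _
  have hsurj : Function.Surjective π := QuotientGroup.mk'_surjective _
  choose g hg using fun i : Fin n => hsurj (φ (π (PresentedGroup.of i)))
  obtain ⟨y, hy, hbraid⟩ := exists_braid_lift π hker.le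
    fun i => if h : i < n then g ⟨i, h⟩ else 1
  have hy' : ∀ i : Fin n, π (y i) = φ (π (PresentedGroup.of i)) := fun i => by
    rw [hy, dif_pos i.2, hg]
  -- The Artin relations hold modulo the center.
  have hmod : ∀ i j : Fin n, π (altProd (y i) (y j) (CoxeterMatrix.B n i j)) =
      π (altProd (y j) (y i) (CoxeterMatrix.B n i j)) := by
    intro i j
    have := congrArg (fun g => φ (π g)) (altProd_of (M := CoxeterMatrix.B n) i j)
    simpa only [map_altProd, ← hy'] using this
  -- The sides of a relation of even length have equal images in the abelian group `ℤ`.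
  have hlen : ∀ u v : ArtinB n, π u = π v →
      ArtinGroup.lengthHom (CoxeterMatrix.B n) u = ArtinGroup.lengthHom _ v → u = v := by
    intro u v h1 h2
    rw [← mul_inv_eq_one]
    refine eq_one_of_mem_center_of_lengthHom_eq_one (by omega) ?_ ?_
    · rw [← hker, MonoidHom.mem_ker, map_mul, map_inv, h1, mul_inv_cancel]
    · rw [map_mul, map_inv, h2, mul_inv_cancel]
  have hrel : ∀ i j : Fin n, i ≠ j → altProd (y i) (y j) (CoxeterMatrix.B n i j) =
      altProd (y j) (y i) (CoxeterMatrix.B n i j) := by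
    intro i j hij
    have h := hmod i j
    rcases CoxeterMatrix.B_apply_cases hij with ⟨e, -⟩ | ⟨e, hadj⟩ | ⟨e, -⟩ <;> rw [e] at h ⊢
    · refine hlen _ _ h ?_
      simp only [altProd, map_mul, mul_one]
      simp only [mul_comm, mul_left_comm]
    · simp only [altProd, mul_one, ← mul_assoc] at h ⊢
      rcases hadj with ⟨hadj, -⟩ | ⟨hadj, -⟩
      · rw [← hadj] at h ⊢
        exact hbraid i h
      · rw [← hadj] at h ⊢
        exact (hbraid j h.symm).symm
    · refine hlen _ _ h ?_
      simp only [altProd, map_mul, mul_one]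
      exact mul_comm _ _
  refine ⟨ArtinGroup.lift (fun i => y i) hrel, PresentedGroup.ext fun i => ?_⟩
  rw [MonoidHom.comp_apply, MonoidHom.comp_apply, ArtinGroup.lift_of]
  exact hy' i
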